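/- Let $m\ge 1$ and $e\ge 2$ be integers and let $p$ be a prime with $\gcd(m,p)=1$ and $5\mid p-1$. Let $r\in\mathbb{Z}_m$ satisfy $r^4+r^3+r^2+r+1=0$ in $\mathbb{Z}_m$, and let $\lambda$ be an element of order $5$ in the multiplicative group $\mathbb{Z}_{p^e}^*$. Let $$G=\mathrm{Dih}(\mathbb{Z}_m\times\mathbb{Z}_{p^e}\times\mathbb{Z}_p)=\langle a,b,c,h\mid a^m=b^{p^e}=c^p=h^2=[a,b]=[a,c]=[b,c]=1,\ a^h=a^{-1},\ b^h=b^{-1},\ c^h=c^{-1}\rangle$$ and define the subsets $$\begin{aligned} T_1&=\{h,\ hab,\ ha^{r+1}b^{\lambda+1}c,\ ha^{r^2+r+1}b^{\lambda^2+\lambda+1}c^{\lambda^4+\lambda+1},\ ha^{r^3+r^2+r+1}b^{\lambda^3+\lambda^2+\lambda+1}c\},\\ T_2&=\{h,\ hab,\ ha^{r+1}b^{\lambda+1}c,\ ha^{r^2+r+1}b^{\lambda^2+\lambda+1}c^{\lambda^3+\lambda+1},\ ha^{r^3+r^2+r+1}b^{\lambda^3+\lambda^2+\lambda+1}c^{\lambda}\},\\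 T_3&=\{h,\ hab,\ ha^{r+1}b^{\lambda+1}c,\ ha^{r^2+r+1}b^{\lambda^2+\lambda+1}c^{\lambda^2+\lambda+1},\ ha^{r^3+r^2+r+1}b^{\lambda^3+\lambda^2+\lambda+1}c^{\lambda^2}\} \end{aligned}$$ of $G$. For $i=1,2,3$ let $\mathcal{CGD}^i_{mp^e\times p}=\mathrm{Cay}(G,T_i)$ be the Cayley graph with vertex set $G$ and edge set $\{\{g,sg\}\mid g\in G,\ s\in T_i\}$. Then the graphs $\mathcal{CGD}^1_{mp^e\times p}$, $\mathcal{CGD}^2_{mp^e\times p}$ and $\mathcal{CGD}^3_{mp^e\times p}$ are pairwise non-isomorphic. -/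

import Mathlib

/-- The Cayley graph `Cay(G, S)`: the edges are the pairs `{g, s g}` with `g ∈ G` and `s ∈ S`. -/
def cayleyGraph {G : Type*} [Group G] (S : Set G) : SimpleGraph G :=
  SimpleGraph.fromRel fun g k => ∃ s ∈ S, k = s * g

/-- The action of `ℤ₂` (written multiplicatively) on an abelian group `H`
whose nontrivial element acts by inversion. -/
def inversionAction (H : Type*) [CommGroup H] : Multiplicative (ZMod 2) →* MulAut H where
  toFun t := if t = 1 then 1 else MulEquiv.inv H
  map_one' := by simp
  map_mul' s t := by
    have key : ∀ u : Multiplicative (ZMod 2), u = 1 ∨ u = Multiplicative.ofAdd 1 := by decide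
    have h1 : (Multiplicative.ofAdd 1 : Multiplicative (ZMod 2)) ≠ 1 := by decide
    have h2 : (Multiplicative.ofAdd 1 * Multiplicative.ofAdd 1 : Multiplicative (ZMod 2)) = 1 := by
      decide
    rcases key s with rfl | rfl <;> rcases key t with rfl | rfl
    · simp
    · simp
    · simp
    · rw [h2, if_pos rfl, if_neg h1]
      ext x
      simp

/-- The generalized dihedral group `Dih(H) = H ⋊ ℤ₂` of an abelian group `H`. -/
abbrev Dih (H : Type*) [CommGroup H] : Type _ :=
  H ⋊[inversionAction H] Multiplicative (ZMod 2)

/-- The group `G = Dih(ℤ_m × ℤ_{p^e} × ℤ_p)`. -/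
abbrev CGDGroup (m p e : ℕ) : Type :=
  Dih (Multiplicative (ZMod m × ZMod (p ^ e) × ZMod p))

namespace CGDGroup

/-- The involution `h` of `G`, inverting `ℤ_m × ℤ_{p^e} × ℤ_p`. -/
def h (m p e : ℕ) : CGDGroup m p e :=
  SemidirectProduct.inr (Multiplicative.ofAdd 1)

/-- The element `a^i b^j c^k` of `G`, where `a`, `b`, `c` are the standard generators of the
factors `ℤ_m`, `ℤ_{p^e}`, `ℤ_p`; the exponents are taken modulo the orders of `a`, `b`, `c`. -/
def abc {m p e : ℕ} (i : ZMod m) (j : ZMod (p ^ e)) (k : ZMod p) : CGDGroup m p e :=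
  SemidirectProduct.inl (Multiplicative.ofAdd (i, j, k))

end CGDGroup

open CGDGroup in
/-- The connection set `T₁(r, l)`. In the exponent of `c`, which has order `p`, the number
`l ∈ ℤ_{p^e}` is reduced modulo `p`. -/
def T₁ {m p e : ℕ} (r : ZMod m) (l : ZMod (p ^ e)) : Set (CGDGroup m p e) :=
  let l' : ZMod p := l.cast
  {h m p e,
   h m p e * abc 1 1 0,
   h m p e * abc (r + 1) (l + 1) 1,
   h m p e * abc (r ^ 2 + r + 1) (l ^ 2 + l + 1) (l' ^ 4 + l' + 1),
   h m p e * abc (r ^ 3 + r ^ 2 + r + 1) (l ^ 3 + l ^ 2 + l + 1) 1}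

open CGDGroup in
/-- The connection set `T₂(r, l)`. -/
def T₂ {m p e : ℕ} (r : ZMod m) (l : ZMod (p ^ e)) : Set (CGDGroup m p e) :=
  let l' : ZMod p := l.cast
  {h m p e,
   h m p e * abc 1 1 0,
   h m p e * abc (r + 1) (l + 1) 1,
   h m p e * abc (r ^ 2 + r + 1) (l ^ 2 + l + 1) (l' ^ 3 + l' + 1),
   h m p e * abc (r ^ 3 + r ^ 2 + r + 1) (l ^ 3 + l ^ 2 + l + 1) l'}

open CGDGroup in
/-- The connection set `T₃(r, l)`. -/
def T₃ {m p e : ℕ} (r : ZMod m) (l : ZMod (p ^ e)) : Set (CGDGroup m p e) :=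
  let l' : ZMod p := l.cast
  {h m p e,
   h m p e * abc 1 1 0,
   h m p e * abc (r + 1) (l + 1) 1,
   h m p e * abc (r ^ 2 + r + 1) (l ^ 2 + l + 1) (l' ^ 2 + l' + 1),
   h m p e * abc (r ^ 3 + r ^ 2 + r + 1) (l ^ 3 + l ^ 2 + l + 1) (l' ^ 2)}

/-- The graph `CGD¹_{mp^e × p} = Cay(G, T₁(r, l))`. -/
def CGD₁ {m p e : ℕ} (r : ZMod m) (l : ZMod (p ^ e)) : SimpleGraph (CGDGroup m p e) :=
  cayleyGraph (T₁ r l)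

/-- The graph `CGD²_{mp^e × p} = Cay(G, T₂(r, l))`. -/
def CGD₂ {m p e : ℕ} (r : ZMod m) (l : ZMod (p ^ e)) : SimpleGraph (CGDGroup m p e) :=
  cayleyGraph (T₂ r l)

/-- The graph `CGD³_{mp^e × p} = Cay(G, T₃(r, l))`. -/
def CGD₃ {m p e : ℕ} (r : ZMod m) (l : ZMod (p ^ e)) : SimpleGraph (CGDGroup m p e) :=
  cayleyGraph (T₃ r l)

/-!
The three graphs are Cayley graphs of `G = Dih(H)`, `H = ℤ_m × ℤ_{p^e} × ℤ_p`, on five involutions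
`s j = h t j`, so that each edge `{g, s j * g}` has a well-defined colour `j`. The proof recovers the
colouring from the graph, and then the affine relations among the vectors `t j` from the colouring.

A product of three of these involutions is again an involution, so for distinct colours `a`, `b`, `c`
the walk with colours `a, b, c, a, b, c` closes up to a hexagon. An isomorphism maps it to a closed walk
of length six, which gives an equality between two sums of three vectors `t' j`. If such equalities are
all trivial, opposite edges of the image have the same colour too; comparing hexagons shows that the
isomorphism permutes the colours in the same way at each vertex (`colour_map_constant`). Hence it
induces a homomorphism from the subgroup generated by the `s j` to the group of the target sending
`s j` to `s' (σ j)` for a permutation `σ` (`exists_bijective_relations_preserved`).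

Up to affine maps, the second coordinates of the `t j` are the powers of the fifth root of unity `l`.
Modulo `p ^ e` with `e ≥ 2` two sums of three of these powers coincide only trivially, since
the norm of the difference would be a multiple of `p ^ e ≥ 121` while, divided by `5`, it is at
most `101` (`eq_zero_of_short_combination`). This is the first use of `e ≥ 2`.

Up to affine maps, the last coordinates of the `t j` are the powers of `κ = l ^ 4`, `l ^ 3`, `l ^ 2`
modulo `p` for the three connection sets. The relations among the vectors `t j` determine `κ`
(`exponents_eq_of_relations_preserved`, the second use of `e ≥ 2`), so the three graphs are not isomorphic.
-/

/-! ### Cayley graphs on involutions -/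

theorem cayleyGraph_range_adj {G ι : Type*} [Group G] {s : ι → G} (hs : ∀ i, s i * s i = 1)
    (hs1 : ∀ i, s i ≠ 1) {g k : G} :
    (cayleyGraph (Set.range s)).Adj g k ↔ ∃ i, k = s i * g := by
  simp only [cayleyGraph, SimpleGraph.fromRel_adj, Set.exists_range_iff]
  constructor
  · rintro ⟨-, ⟨i, hi⟩ | ⟨i, hi⟩⟩
    · exact ⟨i, hi⟩
    · exact ⟨i, by rw [hi, ← mul_assoc, hs, one_mul]⟩
  · rintro ⟨i, hi⟩
    refine ⟨fun h => hs1 i ?_, Or.inl ⟨i, hi⟩⟩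
    rw [← h] at hi
    exact right_eq_mul.mp hi

/-- An isomorphism of Cayley graphs on involutions maps the edge of colour `i` at `v` to an edge of some
colour `σ v i`; the two ends of an edge give it the same colour. -/
theorem exists_colour_map {G ι : Type*} [Group G] [Finite ι] {s s' : ι → G}
    (hs : ∀ i, s i * s i = 1) (hs' : ∀ i, s' i * s' i = 1)
    (hs1 : ∀ i, s i ≠ 1) (hs1' : ∀ i, s' i ≠ 1) (hinj : Function.Injective s)
    (f : cayleyGraph (Set.range s) ≃g cayleyGraph (Set.range s')) :
    ∃ σ : G → ι → ι, (∀ v i, f (s i * v) = s' (σ v i) * f v) ∧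
      (∀ v, Function.Bijective (σ v)) ∧ ∀ v i, σ (s i * v) i = σ v i := by
  have h : ∀ v i, ∃ j, f (s i * v) = s' j * f v := fun v i =>
    (cayleyGraph_range_adj hs' hs1').mp
      (f.map_adj_iff.mpr ((cayleyGraph_range_adj hs hs1).mpr ⟨i, rfl⟩))
  choose σ hσ using h
  have inj : ∀ v, Function.Injective (σ v) := fun v i j hij => by
    have := (hσ v i).trans ((congrArg (fun k => s' k * f v) hij).trans (hσ v j).symm)
    exact hinj (mul_right_cancel (f.injective this))
  have hinj' : Function.Injective s' := by
    -- the neighbours of `f 1` are the images of those of `1`, and there are as many as colours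
    intro i j hij
    obtain ⟨a, rfl⟩ := (Finite.injective_iff_surjective.mp (inj 1)) i
    obtain ⟨b, rfl⟩ := (Finite.injective_iff_surjective.mp (inj 1)) j
    have : f (s a * 1) = f (s b * 1) := by rw [hσ, hσ, hij]
    rw [hinj (mul_right_cancel (f.injective this))]
  refine ⟨σ, hσ, fun v => ⟨inj v, Finite.injective_iff_surjective.mp (inj v)⟩, fun v i => ?_⟩
  have h1 := hσ (s i * v) i
  rw [← mul_assoc, hs, one_mul, hσ v i, ← mul_assoc] at h1
  have h2 : s' (σ (s i * v) i) * s' (σ v i) = 1 := right_eq_mul.mp h1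
  exact hinj' (mul_right_cancel (h2.trans (hs' (σ v i)).symm))

/-- The colour map of an isomorphism is the same at both ends of an edge. The hypothesis `hhex` says
that in a closed walk of length six the colour of an edge is also the colour of a neighbouring edge or
of the opposite edge. -/
theorem colour_map_constant {G ι : Type*} [Group G] {s s' : ι → G}
    (hs : ∀ i, s i * s i = 1) (hcomm : ∀ a b c, s a * s b * s c = s c * s b * s a)
    (hhex : ∀ a b c d e k, s' a * s' b * s' c * s' d * s' e * s' k = 1 → a = b ∨ a = d ∨ a = k)
    (hinj : Function.Injective s)
    {f : G → G} (hf : Function.Injective f) {σ : G → ι → ι}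
    (hσ : ∀ v i, f (s i * v) = s' (σ v i) * f v)
    (hbij : ∀ v, Function.Bijective (σ v)) (hsymm : ∀ v i, σ (s i * v) i = σ v i)
    (v : G) (a : ι) : σ (s a * v) = σ v := by
  -- the hexagon with colours `a, b, c, a, b, c` at `v`
  have hex : ∀ v a b c, a ≠ b → b ≠ c → a ≠ c → σ (s b * (s a * v)) c = σ v c := by
    intro v a b c hab hbc hac
    have e4 : s a * (s c * (s b * (s a * v))) = s b * (s c * v) := by
      have := congrArg (· * (s a * v)) (hcomm a c b)
      simp only [mul_assoc] at this
      rw [this, ← mul_assoc (s a) (s a), hs, one_mul]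
    have e5 : s b * (s a * (s c * (s b * (s a * v)))) = s c * v := by
      rw [e4, ← mul_assoc, hs, one_mul]
    have h1 := hσ v a
    have h2 := hσ (s a * v) b
    have h3 := hσ (s b * (s a * v)) c
    have h4 := hσ (s c * (s b * (s a * v))) a
    have h5 := hσ (s b * (s c * v)) b
    have h6 := hσ (s c * v) c
    rw [← mul_assoc (s b) (s b), hs, one_mul] at h5
    rw [← mul_assoc (s c) (s c), hs, one_mul] at h6
    rw [e4] at h4
    have hprod : s' (σ v c) * s' (σ (s b * (s c * v)) b) * s' (σ (s c * (s b * (s a * v))) a)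
        * s' (σ (s b * (s a * v)) c) * s' (σ (s a * v) b) * s' (σ v a) = 1 := by
      apply mul_right_cancel (b := f v)
      rw [hsymm] at h6
      rw [one_mul]
      conv_rhs => rw [h6, h5, h4, h3, h2, h1]
      simp only [mul_assoc]
    rcases hhex _ _ _ _ _ _ hprod with h | h | h
    · rw [hsymm, ← hsymm v c] at h
      exact absurd ((hbij _).1 h).symm hbc
    · exact h.symm
    · exact absurd ((hbij _).1 h).symm hac
  have two : ∀ v a b, a ≠ b → σ (s b * (s a * v)) b = σ v b := by
    intro v a b hab
    obtain ⟨d, hd⟩ := (hbij v).2 (σ (s b * (s a * v)) b)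
    by_cases hdb : d = b
    · rw [← hd, hdb]
    by_cases hda : d = a
    · -- equal colours would make the two distinct neighbours `v` and `s b * (s a * v)` of
      -- `s a * v` have the same image
      exfalso
      subst hda
      have h1 := hσ v d
      have h2 := hσ (s b * (s d * v)) b
      rw [← mul_assoc (s b) (s b), hs, one_mul, ← hd, h1] at h2
      have h3 := hf (mul_left_cancel h2)
      rw [← mul_assoc] at h3
      have h4 : s b * s d = 1 := right_eq_mul.mp h3
      exact hab (hinj (mul_left_cancel (h4.trans (hs b).symm)))
    · exfalso
      rw [← hex v a b d hab (Ne.symm hdb) (Ne.symm hda)] at hd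
      exact hdb ((hbij _).1 hd)
  funext b
  by_cases hab : a = b
  · rw [← hab, hsymm]
  · rw [← two v a b hab, hsymm]

/-- The pairs `(s i, s' (σ i))` generate the graph of a homomorphism: a word in the `s i` that is
trivial stays trivial when each `s i` is replaced by `s' (σ i)`. -/
theorem exists_bijective_relations_preserved {G ι : Type*} [Group G] [Finite ι] {s s' : ι → G}
    (hs : ∀ i, s i * s i = 1) (hs' : ∀ i, s' i * s' i = 1)
    (hs1 : ∀ i, s i ≠ 1) (hs1' : ∀ i, s' i ≠ 1) (hinj : Function.Injective s)
    (hcomm : ∀ a b c, s a * s b * s c = s c * s b * s a)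
    (hhex : ∀ a b c d e k, s' a * s' b * s' c * s' d * s' e * s' k = 1 → a = b ∨ a = d ∨ a = k)
    (f : cayleyGraph (Set.range s) ≃g cayleyGraph (Set.range s')) :
    ∃ σ : ι → ι, Function.Bijective σ ∧
      ∀ g ∈ Subgroup.closure (Set.range fun i => (s i, s' (σ i))), g.1 = 1 → g.2 = 1 := by
  obtain ⟨σ, hσ, hbij, hsymm⟩ := exists_colour_map hs hs' hs1 hs1' hinj f
  have hconst := colour_map_constant hs hcomm hhex hinj f.injective hσ hbij hsymm
  refine ⟨σ 1, hbij 1, fun g hg => ?_⟩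
  have step : ∀ i, ∀ y : G × G, (f y.1 = y.2 * f 1 ∧ σ y.1 = σ 1) →
      f (s i * y.1) = s' (σ 1 i) * y.2 * f 1 ∧ σ (s i * y.1) = σ 1 := fun i y hy =>
    ⟨by rw [hσ, hy.2, hy.1, mul_assoc], by rw [hconst, hy.2]⟩
  have key : f g.1 = g.2 * f 1 ∧ σ g.1 = σ 1 := by
    induction hg using Subgroup.closure_induction_left with
    | one => simp
    | mul_left x hx y hy ih =>
      obtain ⟨i, rfl⟩ := hx
      exact step i y ih
    | inv_mul_cancel x hx y hy ih =>
      obtain ⟨i, rfl⟩ := hx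
      simp only [Prod.fst_mul, Prod.snd_mul, Prod.fst_inv, Prod.snd_inv,
        inv_eq_of_mul_eq_one_left (hs i), inv_eq_of_mul_eq_one_left (hs' (σ 1 i))]
      exact step i y ih
  intro h
  have h1 := key.1
  rw [h] at h1
  exact right_eq_mul.mp h1

/-! ### Fifth roots of unity modulo a prime power -/

theorem isUnit_of_castHom_ne_zero {p e : ℕ} (hp : p.Prime) (h : p ∣ p ^ e) {x : ZMod (p ^ e)}
    (hx : ZMod.castHom h (ZMod p) x ≠ 0) : IsUnit x := by
  have : NeZero (p ^ e) := ⟨pow_ne_zero _ hp.ne_zero⟩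
  rw [← ZMod.natCast_zmod_val x, ZMod.isUnit_iff_coprime]
  refine Nat.Coprime.pow_right _ ((hp.coprime_iff_not_dvd.mpr fun h => hx ?_).symm)
  rw [← ZMod.natCast_zmod_val x, map_natCast]
  exact (ZMod.natCast_eq_zero_iff _ _).mpr h

theorem castHom_eq_zero_of_prime_mul_eq_zero {p e : ℕ} (hp : p.Prime) (he : 2 ≤ e)
    (h : p ∣ p ^ e) {x : ZMod (p ^ e)} (hx : (p : ZMod (p ^ e)) * x = 0) :
    ZMod.castHom h (ZMod p) x = 0 := by
  by_contra hne
  have h1 := ((isUnit_of_castHom_ne_zero hp h hne).mul_left_eq_zero).mp hx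
  rw [ZMod.natCast_eq_zero_iff] at h1
  exact absurd ((Nat.pow_dvd_pow_iff_le_right hp.one_lt).mp (by simpa using h1 : p ^ e ∣ p ^ 1))
    (by omega)

theorem eleven_le_of_five_dvd_sub_one {p : ℕ} (hp : p.Prime) (h : 5 ∣ p - 1) : 11 ≤ p := by
  have h2 := hp.two_le
  by_contra! hlt
  interval_cases p <;> first | omega | (revert hp; norm_num)

theorem five_ne_zero_of_eleven_le {p : ℕ} (h : 11 ≤ p) : (5 : ZMod p) ≠ 0 := fun h5 => by
  have h1 : ((5 : ℕ) : ZMod p) = 0 := by exact_mod_cast h5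
  rw [ZMod.natCast_eq_zero_iff] at h1
  exact absurd (Nat.le_of_dvd (by norm_num) h1) (by omega)

theorem castHom_ne_one_of_pow_five_eq_one {p e : ℕ} (hp : p.Prime) (h11 : 11 ≤ p) (h : p ∣ p ^ e)
    {x : ZMod (p ^ e)} (h5 : x ^ 5 = 1) (hx : x ≠ 1) : ZMod.castHom h (ZMod p) x ≠ 1 := by
  intro h1
  have hu : IsUnit (x ^ 4 + x ^ 3 + x ^ 2 + x + 1) := by
    apply isUnit_of_castHom_ne_zero hp h
    simp only [map_add, map_pow, map_one, h1]
    convert five_ne_zero_of_eleven_le h11 using 1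
    norm_num
  have h0 : (x - 1) * (x ^ 4 + x ^ 3 + x ^ 2 + x + 1) = 0 := by linear_combination h5
  exact hx (sub_eq_zero.mp ((hu.mul_left_eq_zero).mp h0))

theorem cyclotomic_five_eq_zero {p e : ℕ} (hp : p.Prime) (h11 : 11 ≤ p) (h : p ∣ p ^ e)
    {x : ZMod (p ^ e)} (h5 : x ^ 5 = 1) (hx : x ≠ 1) :
    x ^ 4 + x ^ 3 + x ^ 2 + x + 1 = 0 := by
  have hu : IsUnit (x - 1) := by
    apply isUnit_of_castHom_ne_zero hp h
    rw [map_sub, map_one]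
    exact sub_ne_zero.mpr (castHom_ne_one_of_pow_five_eq_one hp h11 h h5 hx)
  refine (hu.mul_right_eq_zero).mp ?_
  linear_combination h5

theorem eq_zero_of_five_mul_sq_eq_sq {a b : ℤ} (h : 5 * a ^ 2 = b ^ 2) : a = 0 := by
  by_contra ha
  have hirr : Irrational (√(5 : ℕ)) := Nat.Prime.irrational_sqrt (by norm_num)
  apply hirr
  refine ⟨|b| / |a|, ?_⟩
  have ha' : (a : ℝ) ≠ 0 := by exact_mod_cast ha
  push_cast
  symm
  rw [Real.sqrt_eq_iff_mul_self_eq_of_pos, ← sq, div_pow, sq_abs, sq_abs, div_eq_iff (by positivity)]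
  · have h' := congrArg (Int.cast : ℤ → ℝ) h
    push_cast at h' ⊢
    exact h'.symm
  · have hb : b ≠ 0 := by
      rintro rfl
      exact ha (by simpa using h)
    have hb' : (b : ℝ) ≠ 0 := by exact_mod_cast hb
    positivity

/-- If `∑ cⱼ = 0`, then `5 * ((C₁ + C₂) ^ 2 + C₁ * C₂)` is the norm of `∑ cⱼ ζ ^ j`, where `ζ` is a
primitive fifth root of unity and `C₁`, `C₂` are the cyclic autocorrelations of `c`. It vanishes in every
ring in which the element itself vanishes at a root `x` of the cyclotomic polynomial. -/
theorem norm_eq_zero_of_combination_eq_zero {R : Type*} [CommRing R] {x c₀ c₁ c₂ c₃ c₄ C₁ C₂ : R}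
    (hx : x ^ 4 + x ^ 3 + x ^ 2 + x + 1 = 0) (hsum : c₀ + c₁ + c₂ + c₃ + c₄ = 0)
    (hC₁ : C₁ = c₀ * c₁ + c₁ * c₂ + c₂ * c₃ + c₃ * c₄ + c₄ * c₀)
    (hC₂ : C₂ = c₀ * c₂ + c₁ * c₃ + c₂ * c₄ + c₃ * c₀ + c₄ * c₁)
    (hc : c₀ + c₁ * x + c₂ * x ^ 2 + c₃ * x ^ 3 + c₄ * x ^ 4 = 0) :
    5 * ((C₁ + C₂) ^ 2 + C₁ * C₂) = 0 := by
  have hx5 : x ^ 5 = 1 := by linear_combination (x - 1) * hx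
  -- `u` and `v` are the two Gaussian periods
  obtain ⟨u, hu⟩ : ∃ u, u = x + x ^ 4 := ⟨_, rfl⟩
  obtain ⟨v, hv⟩ : ∃ v, v = x ^ 2 + x ^ 3 := ⟨_, rfl⟩
  have huv : u + v = -1 := by rw [hu, hv]; linear_combination hx
  have huv' : u * v = -1 := by rw [hu, hv]; linear_combination hx + (x + x ^ 2) * hx5
  -- the product of `∑ cⱼ x ^ j` and `∑ cⱼ x ^ (-j)`
  have hA : -2 * (C₁ + C₂) + C₁ * u + C₂ * v = 0 := by
    rw [hC₁, hC₂, hu, hv]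
    linear_combination (c₀ + c₁ * x ^ 4 + c₂ * x ^ 3 + c₃ * x ^ 2 + c₄ * x) * hc
      - (c₀ + c₁ + c₂ + c₃ + c₄) * hsum
      - ((c₁ ^ 2 + c₂ ^ 2 + c₃ ^ 2 + c₄ ^ 2) + (c₂ * c₁ + c₃ * c₂ + c₄ * c₃) * x
        + (c₃ * c₁ + c₄ * c₂) * x ^ 2 + c₄ * c₁ * x ^ 3) * hx5
  linear_combination (-2 * (C₁ + C₂) + C₁ * v + C₂ * u) * hA + 2 * (C₁ + C₂) ^ 2 * huv
    - (C₁ ^ 2 + C₂ ^ 2) * huv' - C₁ * C₂ * (u + v - 1) * huv + 2 * C₁ * C₂ * huv'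

/-- The powers of a primitive fifth root of unity modulo `p ^ e ≥ 121` satisfy no short affine relation
with integer coefficients: the norm of `∑ cⱼ ζ ^ j` is `5 * ((C₁ + C₂) ^ 2 + C₁ * C₂)`, and when
`∑ cⱼ ^ 2 ≤ 18` the second factor is at most `101` in absolute value. -/
theorem eq_zero_of_short_combination {p e : ℕ} (hp : p.Prime) (h11 : 11 ≤ p) (he : 2 ≤ e)
    {x : ZMod (p ^ e)} (hx : x ^ 4 + x ^ 3 + x ^ 2 + x + 1 = 0)
    (c : Fin 5 → ℤ) (hsum : ∑ j, c j = 0) (hsq : ∑ j, c j ^ 2 ≤ 18)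
    (hc : ∑ j, (c j : ZMod (p ^ e)) * x ^ (j : ℕ) = 0) : c = 0 := by
  simp only [Fin.sum_univ_five] at hsum hsq hc
  obtain ⟨C₁, hC₁⟩ : ∃ C, C = c 0 * c 1 + c 1 * c 2 + c 2 * c 3 + c 3 * c 4 + c 4 * c 0 := ⟨_, rfl⟩
  obtain ⟨C₂, hC₂⟩ : ∃ C, C = c 0 * c 2 + c 1 * c 3 + c 2 * c 4 + c 3 * c 0 + c 4 * c 1 := ⟨_, rfl⟩
  obtain ⟨C₀, hC₀⟩ : ∃ C, C = c 0 ^ 2 + c 1 ^ 2 + c 2 ^ 2 + c 3 ^ 2 + c 4 ^ 2 := ⟨_, rfl⟩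
  have hC : C₀ = -2 * (C₁ + C₂) := by
    rw [hC₀, hC₁, hC₂]
    linear_combination (c 0 + c 1 + c 2 + c 3 + c 4) * hsum
  have h₁ : -C₀ ≤ C₁ := by
    linarith [sq_nonneg (c 0 + c 1), sq_nonneg (c 1 + c 2), sq_nonneg (c 2 + c 3),
      sq_nonneg (c 3 + c 4), sq_nonneg (c 4 + c 0)]
  have h₂ : -C₀ ≤ C₂ := by
    linarith [sq_nonneg (c 0 + c 2), sq_nonneg (c 1 + c 3), sq_nonneg (c 2 + c 4),
      sq_nonneg (c 3 + c 0), sq_nonneg (c 4 + c 1)]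
  have hN : (5 : ZMod (p ^ e)) * (((C₁ + C₂) ^ 2 + C₁ * C₂ : ℤ) : ZMod (p ^ e)) = 0 := by
    push_cast
    refine norm_eq_zero_of_combination_eq_zero (c₀ := (c 0 : ZMod (p ^ e))) (c₁ := c 1) (c₂ := c 2)
      (c₃ := c 3) (c₄ := c 4) hx ?_ ?_ ?_ ?_
    · exact_mod_cast congrArg (Int.cast : ℤ → ZMod (p ^ e)) hsum
    · exact_mod_cast congrArg (Int.cast : ℤ → ZMod (p ^ e)) hC₁
    · exact_mod_cast congrArg (Int.cast : ℤ → ZMod (p ^ e)) hC₂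
    · simpa using hc
  have hdvd : ((p ^ e : ℕ) : ℤ) ∣ (C₁ + C₂) ^ 2 + C₁ * C₂ := by
    rw [← ZMod.intCast_zmod_eq_zero_iff_dvd]
    refine (IsUnit.mul_right_eq_zero ?_).mp hN
    apply isUnit_of_castHom_ne_zero hp (dvd_pow_self p (by omega))
    rw [map_ofNat]
    exact five_ne_zero_of_eleven_le h11
  have hpe : (121 : ℤ) ≤ ((p ^ e : ℕ) : ℤ) := by
    have : 11 ^ 2 ≤ p ^ e := (Nat.pow_le_pow_left h11 2).trans (Nat.pow_le_pow_right hp.pos he)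
    exact_mod_cast this
  have hpos : 0 ≤ C₀ := by rw [hC₀]; positivity
  have hle : C₀ ≤ 18 := hC₀ ▸ hsq
  have hzero : (C₁ + C₂) ^ 2 + C₁ * C₂ = 0 := by
    apply Int.eq_zero_of_abs_lt_dvd hdvd
    refine lt_of_lt_of_le ?_ hpe
    have hsq : C₀ ^ 2 ≤ 324 := by nlinarith
    rw [abs_lt]
    -- with `C₁ + C₂ = -C₀ / 2` the upper bound is `5 / 16 * C₀ ^ 2`
    constructor
    · nlinarith [mul_nonneg (by linarith : 0 ≤ C₁ + C₀) (by linarith : 0 ≤ C₂ + C₀)]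
    · nlinarith [sq_nonneg (C₁ - C₂)]
  -- four times the vanishing integer is `5 * (C₁ + C₂) ^ 2 - (C₁ - C₂) ^ 2`
  have hS : C₁ + C₂ = 0 :=
    eq_zero_of_five_mul_sq_eq_sq (b := C₁ - C₂) (by linear_combination 4 * hzero)
  have hC₀' : c 0 ^ 2 + c 1 ^ 2 + c 2 ^ 2 + c 3 ^ 2 + c 4 ^ 2 = 0 := by
    rw [← hC₀, hC, hS, mul_zero]
  have hj : ∀ j, c j ^ 2 = 0 := by
    have := Finset.sum_eq_zero_iff_of_nonneg (s := Finset.univ) (f := fun j => c j ^ 2)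
      (fun j _ => sq_nonneg _)
    rw [Fin.sum_univ_five] at this
    exact fun j => this.mp hC₀' j (Finset.mem_univ j)
  exact funext fun j => pow_eq_zero_iff two_ne_zero |>.mp (hj j)

/-- Two sums of three powers of a primitive fifth root of unity modulo `p ^ e` coincide only
trivially. -/
theorem powers_sum_three {p e : ℕ} (hp : p.Prime) (h11 : 11 ≤ p) (he : 2 ≤ e)
    {x : ZMod (p ^ e)} (hx : x ^ 4 + x ^ 3 + x ^ 2 + x + 1 = 0) {a b c d k l : Fin 5}
    (h : x ^ (a : ℕ) + x ^ (b : ℕ) + x ^ (c : ℕ) = x ^ (d : ℕ) + x ^ (k : ℕ) + x ^ (l : ℕ)) :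
    a = d ∨ a = k ∨ a = l := by
  -- `u a b c j` counts how often `j` occurs among `a`, `b`, `c`
  let u : Fin 5 → Fin 5 → Fin 5 → Fin 5 → ℤ := fun a b c j =>
    (if a = j then 1 else 0) + (if b = j then 1 else 0) + (if c = j then 1 else 0)
  have hsum : ∀ a b c, ∑ j, u a b c j = 3 := fun a b c => by
    simp [u, Finset.sum_add_distrib]
  have hpow : ∀ a b c, ∑ j : Fin 5, (u a b c j : ZMod (p ^ e)) * x ^ (j : ℕ) =
      x ^ (a : ℕ) + x ^ (b : ℕ) + x ^ (c : ℕ) := fun a b c => by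
    simp [u, add_mul, Finset.sum_add_distrib]
  have hnonneg : ∀ a b c j, 0 ≤ u a b c j := fun a b c j => by
    simp only [u]; positivity
  have hle : ∀ a b c j, u a b c j ≤ 3 := fun a b c j => by
    rw [← hsum a b c]
    exact Finset.single_le_sum (fun i _ => hnonneg a b c i) (Finset.mem_univ j)
  have h0 := eq_zero_of_short_combination hp h11 he hx (fun j => u a b c j - u d k l j)
    (by rw [Finset.sum_sub_distrib, hsum, hsum, sub_self]) ?_ ?_
  · have h1 : u a b c a = u d k l a := sub_eq_zero.mp (congrFun h0 a)
    by_contra! hne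
    have h2 : u d k l a = 0 := by simp [u, hne.1.symm, hne.2.1.symm, hne.2.2.symm]
    have h3 : 1 ≤ u a b c a := by
      simp only [u, if_true]; split_ifs <;> norm_num
    omega
  · calc ∑ j, (u a b c j - u d k l j) ^ 2 ≤ ∑ j, (3 * u a b c j + 3 * u d k l j) :=
          Finset.sum_le_sum fun j _ => by
            nlinarith [hnonneg a b c j, hnonneg d k l j, hle a b c j, hle d k l j]
      _ = 18 := by rw [Finset.sum_add_distrib, ← Finset.mul_sum, ← Finset.mul_sum, hsum, hsum]; rfl
  · push_cast
    simp only [sub_mul, Finset.sum_sub_distrib, hpow, h, sub_self]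

/-! ### Affine relations between powers of a fifth root of unity -/

/-- A sequence of five terms whose differences form a geometric progression of ratio `x`, a primitive
fifth root of unity, has the form `α + β x ^ j`; if its sum vanishes, then `5 α = 0`. -/
theorem eq_mul_pow_of_geometric {F : Type*} [Field F] (h5 : (5 : F) ≠ 0) {x : F}
    (hx : x ^ 4 + x ^ 3 + x ^ 2 + x + 1 = 0) {y : Fin 5 → F} (hy : ∑ j, y j = 0)
    (h₀ : y 2 - y 1 = x * (y 1 - y 0)) (h₁ : y 3 - y 2 = x * (y 2 - y 1))
    (h₂ : y 4 - y 3 = x * (y 3 - y 2)) (j : Fin 5) : y j = y 0 * x ^ (j : ℕ) := by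
  rw [Fin.sum_univ_five] at hy
  have hd : y 1 - y 0 = (x - 1) * y 0 := by
    apply mul_left_cancel₀ h5
    linear_combination (1 - x) * hy + (x - 1) * (h₂ + (x + 2) * h₁ + (x ^ 2 + 2 * x + 3) * h₀)
      + (y 1 - y 0) * hx
  fin_cases j
  · simp
  · simp only [Fin.mk_one, pow_one]; linear_combination hd
  · simp only [Fin.reduceFinMk]; linear_combination h₀ + (1 + x) * hd
  · simp only [Fin.reduceFinMk]; linear_combination h₁ + (1 + x) * h₀ + (1 + x + x ^ 2) * hd
  · simp only [Fin.reduceFinMk]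
    linear_combination h₂ + (1 + x) * h₁ + (1 + x + x ^ 2) * h₀ + (1 + x + x ^ 2 + x ^ 3) * hd

/-- Let `σ` be a permutation of the indices carrying the affine relations among the pairs `(B j, C j)`
to relations among the pairs `(B j, C' j)`, where `B`, `C`, `C'` are affinely equivalent to the powers
of `l`, of `κ` and of `κ'`, in the last two cases up to adding a multiple of `B` modulo `p`. A relation
`(z - 1) (z - l)` among the powers of `l` becomes a relation among the pairs when multiplied by `p`, and
this forces `σ` to be a cyclic shift. The relation `(z - 1) (z - l) (z - κ)` is then carried to itself,
so that `κ'` is a root of this polynomial. -/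
theorem exponents_eq_of_relations_preserved {p e : ℕ} [Fact p.Prime] (h11 : 11 ≤ p) (he : 2 ≤ e)
    (h : p ∣ p ^ e) {l : ZMod (p ^ e)} (hl : l ^ 4 + l ^ 3 + l ^ 2 + l + 1 = 0)
    {x κ κ' : ZMod p} (hlx : ZMod.castHom h (ZMod p) l = x) (hx1 : x ≠ 1)
    {i : ℕ} (hi : κ' = x ^ i)
    (h1 : κ ≠ 1) (hx : κ ≠ x) (h1' : κ' ≠ 1) (hx' : κ' ≠ x)
    {B : Fin 5 → ZMod (p ^ e)} {C C' : Fin 5 → ZMod p}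
    (hB : ∀ j, (l - 1) * B j = l ^ (j : ℕ) - 1)
    (hC : ∀ j, (κ - 1) * (κ - x) * C j
      = κ ^ (j : ℕ) - 1 - (κ - 1) * ZMod.castHom h (ZMod p) (B j))
    (hC' : ∀ j, (κ' - 1) * (κ' - x) * C' j
      = κ' ^ (j : ℕ) - 1 - (κ' - 1) * ZMod.castHom h (ZMod p) (B j))
    {σ : Fin 5 → Fin 5} (hσ : Function.Bijective σ)
    (hrel : ∀ n : Fin 5 → ℤ, ∑ j, n j = 0 → ∑ j, (n j : ZMod (p ^ e)) * B j = 0 →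
      ∑ j, (n j : ZMod p) * C j = 0 →
      ∑ j, (n j : ZMod (p ^ e)) * B (σ j) = 0 ∧ ∑ j, (n j : ZMod p) * C' (σ j) = 0) :
    κ = κ' := by
  have hp : p.Prime := Fact.out
  have : NeZero (p ^ e) := ⟨pow_ne_zero _ hp.ne_zero⟩
  have h5 := five_ne_zero_of_eleven_le h11
  set q := ZMod.castHom h (ZMod p) with hq
  have hu : IsUnit (l - 1) := by
    apply isUnit_of_castHom_ne_zero hp h
    rw [map_sub, map_one, ← hq, hlx]
    exact sub_ne_zero.mpr hx1
  have hΦ : x ^ 4 + x ^ 3 + x ^ 2 + x + 1 = 0 := by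
    rw [← hlx]; simpa using congrArg q hl
  have hx0 : x ≠ 0 := by
    rintro rfl
    norm_num at hΦ
  have hb : ∀ j, (x - 1) * q (B j) = x ^ (j : ℕ) - 1 := fun j => by
    rw [← hlx]; simpa using congrArg q (hB j)
  have hBl : ∀ n : Fin 5 → ℤ, ∑ j, n j = 0 → ∑ j, (n j : ZMod (p ^ e)) * l ^ (j : ℕ) = 0 →
      ∑ j, (n j : ZMod (p ^ e)) * B j = 0 := fun n hn hnl => by
    have hn' := congrArg (Int.cast : ℤ → ZMod (p ^ e)) hn
    push_cast at hn'
    refine (hu.mul_right_eq_zero).mp ?_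
    simp only [Finset.mul_sum, mul_left_comm (l - 1), hB, mul_sub, mul_one, Finset.sum_sub_distrib,
      hnl, hn', sub_zero]
  have hR1 : ∀ n : Fin 5 → ℤ, ∑ j, n j = 0 → ∑ j, (n j : ZMod (p ^ e)) * l ^ (j : ℕ) = 0 →
      ∑ j, (n j : ZMod p) * x ^ (σ j : ℕ) = 0 := fun n hn hnl => by
    have hn' := congrArg (Int.cast : ℤ → ZMod p) hn
    push_cast at hn'
    -- multiplied by `p`, the relation holds trivially in `ZMod p`; the factor can be cancelled
    -- afterwards modulo `p` because `2 ≤ e`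
    have h2 := (hrel (fun j => p * n j) (by rw [← Finset.mul_sum, hn, mul_zero])
      (by simp [mul_assoc, ← Finset.mul_sum, hBl n hn hnl]) (by simp)).1
    simp only [Int.cast_mul, Int.cast_natCast, mul_assoc, ← Finset.mul_sum] at h2
    have h3 := castHom_eq_zero_of_prime_mul_eq_zero hp he h h2
    rw [← hq] at h3
    simp only [map_sum, map_mul, map_intCast] at h3
    have h4 := congrArg ((x - 1) * ·) h3
    simpa only [Finset.mul_sum, mul_left_comm (x - 1), hb, mul_sub, mul_one,
      Finset.sum_sub_distrib, hn', sub_zero, mul_zero] using h4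
  obtain ⟨L, hL⟩ : ∃ L : ℤ, (L : ZMod (p ^ e)) = l := ZMod.intCast_surjective l
  obtain ⟨K, hK⟩ : ∃ K : ℤ, (K : ZMod p) = κ := ZMod.intCast_surjective κ
  have hLx : (L : ZMod p) = x := by rw [← hlx, ← hL, map_intCast]
  have hsum : ∑ j, x ^ (σ j : ℕ) = 0 := by
    rw [hσ.sum_comp (fun j : Fin 5 => x ^ (j : ℕ)), Fin.sum_univ_five]
    change x ^ 0 + x ^ 1 + x ^ 2 + x ^ 3 + x ^ 4 = 0
    linear_combination hΦ
  have hy : ∀ j, x ^ (σ j : ℕ) = x ^ (σ 0 : ℕ) * x ^ (j : ℕ) := by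
    apply eq_mul_pow_of_geometric (y := fun j => x ^ (σ j : ℕ)) h5 hΦ hsum
    -- each instance of `hR1` uses the coefficients of `z ^ k * (z - 1) * (z - L)`
    · have := hR1 ![L, -(L + 1), 1, 0, 0] (by simp [Fin.sum_univ_five])
        (by simp [Fin.sum_univ_five, hL]; ring)
      simp [Fin.sum_univ_five, hLx] at this
      linear_combination this
    · have := hR1 ![0, L, -(L + 1), 1, 0] (by simp [Fin.sum_univ_five])
        (by simp [Fin.sum_univ_five, hL]; ring)
      simp [Fin.sum_univ_five, hLx] at this
      linear_combination this
    · have := hR1 ![0, 0, L, -(L + 1), 1] (by simp [Fin.sum_univ_five])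
        (by simp [Fin.sum_univ_five, hL]; ring)
      simp [Fin.sum_univ_five, hLx] at this
      linear_combination this
  have hκσ : ∀ j, κ' ^ (σ j : ℕ) = κ' ^ (σ 0 : ℕ) * κ' ^ (j : ℕ) := fun j => by
    rw [hi, ← pow_mul, ← pow_mul, ← pow_mul, mul_comm i, mul_comm i, mul_comm i, pow_mul, pow_mul,
      pow_mul, hy, mul_pow]
  -- the coefficients of `(z - 1) * (z - L) * (z - K)`
  obtain ⟨n, hn⟩ : ∃ n : Fin 5 → ℤ,
    n = ![-(L * K), L + K + L * K, -(1 + L + K), 1, 0] := ⟨_, rfl⟩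
  have hn0 : ∑ j, n j = 0 := by rw [hn, Fin.sum_univ_five]; simp
  have hn0' : ∑ j, (n j : ZMod p) = 0 := by
    simpa using congrArg (Int.cast : ℤ → ZMod p) hn0
  have hnl : ∑ j, (n j : ZMod (p ^ e)) * l ^ (j : ℕ) = 0 := by
    simp [hn, Fin.sum_univ_five, hL]; ring
  have hnB := hBl n hn0 hnl
  have hnb : ∑ j, (n j : ZMod p) * q (B j) = 0 := by simpa using congrArg q hnB
  have hnκ : ∑ j, (n j : ZMod p) * κ ^ (j : ℕ) = 0 := by
    simp [hn, Fin.sum_univ_five, hLx, hK]; ring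
  have hnC : ∑ j, (n j : ZMod p) * C j = 0 := by
    refine (mul_eq_zero.mp ?_).resolve_left
      (mul_ne_zero (sub_ne_zero.mpr h1) (sub_ne_zero.mpr hx))
    calc (κ - 1) * (κ - x) * ∑ j, (n j : ZMod p) * C j
        = ∑ j, (n j : ZMod p) * κ ^ (j : ℕ) - ∑ j, (n j : ZMod p)
          - (κ - 1) * ∑ j, (n j : ZMod p) * q (B j) := by
          simp only [Finset.mul_sum, ← Finset.sum_sub_distrib]
          exact Finset.sum_congr rfl fun j _ => by linear_combination (n j : ZMod p) * hC j
      _ = 0 := by rw [hnκ, hn0', hnb, mul_zero, sub_zero, sub_zero]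
  obtain ⟨hnσB, hnσC⟩ := hrel n hn0 hnB hnC
  have hnσb : ∑ j, (n j : ZMod p) * q (B (σ j)) = 0 := by simpa using congrArg q hnσB
  have hfin : κ' ^ (σ 0 : ℕ) * ∑ j, (n j : ZMod p) * κ' ^ (j : ℕ) = 0 := by
    calc κ' ^ (σ 0 : ℕ) * ∑ j, (n j : ZMod p) * κ' ^ (j : ℕ)
        = (κ' - 1) * (κ' - x) * (∑ j, (n j : ZMod p) * C' (σ j)) + ∑ j, (n j : ZMod p)
          + (κ' - 1) * ∑ j, (n j : ZMod p) * q (B (σ j)) := by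
          simp only [Finset.mul_sum, ← Finset.sum_add_distrib]
          exact Finset.sum_congr rfl fun j _ => by
            linear_combination -(n j : ZMod p) * hC' (σ j) - (n j : ZMod p) * hκσ j
      _ = 0 := by rw [hnσC, hn0', hnσb, mul_zero, mul_zero, add_zero, add_zero]
  have hκ0 : κ' ≠ 0 := hi ▸ pow_ne_zero _ hx0
  have h6 := (mul_eq_zero.mp hfin).resolve_left (pow_ne_zero _ hκ0)
  simp [hn, Fin.sum_univ_five, hLx, hK] at h6
  have h7 : (κ' - 1) * (κ' - x) * (κ' - κ) = 0 := by linear_combination h6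
  exact (sub_eq_zero.mp ((mul_eq_zero.mp h7).resolve_left
    (mul_ne_zero (sub_ne_zero.mpr h1') (sub_ne_zero.mpr hx')))).symm

/-! ### Reflections in generalized dihedral groups -/

section Reflections
open SemidirectProduct
variable {H : Type*} [CommGroup H]

/-- The element `h x` of the generalized dihedral group `Dih H`, where `h` is the involution
inverting `H`. -/
def Dih.reflection (x : H) : Dih H := inr (Multiplicative.ofAdd 1) * inl x

theorem Dih.reflection_mul_reflection (x y : H) :
    Dih.reflection x * Dih.reflection y = inl (x⁻¹ * y) := by
  have h1 : inversionAction H (Multiplicative.ofAdd 1) = MulEquiv.inv H :=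
    if_neg (c := (Multiplicative.ofAdd 1 : Multiplicative (ZMod 2)) = 1) (t := 1) (by decide)
  have h2 : (Multiplicative.ofAdd 1 * Multiplicative.ofAdd 1 : Multiplicative (ZMod 2)) = 1 := by
    decide
  apply SemidirectProduct.ext
  · simp [Dih.reflection, h1]
  · simp [Dih.reflection, h2]

theorem Dih.reflection_mul_self (x : H) : Dih.reflection x * Dih.reflection x = 1 := by
  rw [Dih.reflection_mul_reflection, inv_mul_cancel, map_one]

theorem Dih.reflection_mul_inl (x y : H) :
    Dih.reflection x * inl y = Dih.reflection (x * y) := by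
  rw [Dih.reflection, Dih.reflection, map_mul, mul_assoc]

theorem Dih.reflection_injective : Function.Injective (Dih.reflection : H → Dih H) :=
  fun _ _ h => inl_injective (mul_left_cancel h)

theorem Dih.reflection_ne_one (x : H) : Dih.reflection x ≠ 1 := fun h => by
  have h1 := congrArg SemidirectProduct.right h
  simp [Dih.reflection] at h1

theorem Dih.reflection_mul_comm (x y z : H) :
    Dih.reflection x * Dih.reflection y * Dih.reflection z
      = Dih.reflection z * Dih.reflection y * Dih.reflection x := by
  rw [mul_assoc, mul_assoc, Dih.reflection_mul_reflection, Dih.reflection_mul_reflection,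
    Dih.reflection_mul_inl, Dih.reflection_mul_inl, mul_left_comm, mul_comm x, mul_left_comm]

end Reflections

/-- Consider an isomorphism between the Cayley graphs of `Dih A` on two families of reflections, such
that two sums of three members of the second family coincide only trivially. It carries every affine
relation among the first family to the corresponding relation among the second. -/
theorem exists_bijective_relations_preserved_of_sum_three {A : Type*} [AddCommGroup A] {n : ℕ}
    {t t' : Fin (n + 1) → A} (ht : Function.Injective t)
    (ht' : ∀ a b c d e k, t' a + t' b + t' c = t' d + t' e + t' k → a = d ∨ a = e ∨ a = k)
    (f : cayleyGraph (Set.range fun i => Dih.reflection (Multiplicative.ofAdd (t i))) ≃g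
      cayleyGraph (Set.range fun i => Dih.reflection (Multiplicative.ofAdd (t' i)))) :
    ∃ σ : Fin (n + 1) → Fin (n + 1), Function.Bijective σ ∧
      ∀ c : Fin (n + 1) → ℤ, ∑ i, c i = 0 → ∑ i, c i • t i = 0 → ∑ i, c i • t' (σ i) = 0 := by
  have hhex : ∀ a b c d e k : Fin (n + 1), Dih.reflection (Multiplicative.ofAdd (t' a)) *
      Dih.reflection (Multiplicative.ofAdd (t' b)) * Dih.reflection (Multiplicative.ofAdd (t' c)) *
      Dih.reflection (Multiplicative.ofAdd (t' d)) * Dih.reflection (Multiplicative.ofAdd (t' e)) *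
      Dih.reflection (Multiplicative.ofAdd (t' k)) = 1 → a = b ∨ a = d ∨ a = k := by
    intro a b c d e k h
    have h1 : t' a + t' c + t' e = t' b + t' d + t' k := by
      simp only [Dih.reflection_mul_reflection, mul_assoc, ← map_mul, ← ofAdd_neg, ← ofAdd_add] at h
      have h2 := Multiplicative.ofAdd.injective
        (SemidirectProduct.inl_injective (h.trans (map_one SemidirectProduct.inl).symm))
      rw [← sub_eq_zero, ← neg_eq_zero, ← h2]
      abel
    exact ht' _ _ _ _ _ _ h1
  obtain ⟨σ, hσ, hrel⟩ := exists_bijective_relations_preserved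
    (fun i => Dih.reflection_mul_self _) (fun i => Dih.reflection_mul_self _)
    (fun i => Dih.reflection_ne_one _) (fun i => Dih.reflection_ne_one _)
    (fun i j hij => ht (Multiplicative.ofAdd.injective (Dih.reflection_injective hij)))
    (fun a b c => Dih.reflection_mul_comm _ _ _) hhex f
  refine ⟨σ, hσ, fun c hc0 hc => ?_⟩
  set N := Subgroup.closure (Set.range fun i =>
    (Dih.reflection (Multiplicative.ofAdd (t i)), Dih.reflection (Multiplicative.ofAdd (t' (σ i)))))
  let φ : Multiplicative A × Multiplicative A →*
      Dih (Multiplicative A) × Dih (Multiplicative A) :=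
    MonoidHom.prodMap SemidirectProduct.inl SemidirectProduct.inl
  -- the products of two reflections are the translations by differences
  have hmem : ∏ i, (Multiplicative.ofAdd (t i - t 0),
      Multiplicative.ofAdd (t' (σ i) - t' (σ 0))) ^ c i ∈ N.comap φ := by
    refine Subgroup.prod_mem _ fun i _ => Subgroup.zpow_mem _ ?_ _
    have h := N.mul_mem (Subgroup.subset_closure ⟨0, rfl⟩) (Subgroup.subset_closure ⟨i, rfl⟩)
    simp only [Prod.mk_mul_mk, Dih.reflection_mul_reflection, ← ofAdd_neg, ← ofAdd_add,
      neg_add_eq_sub] at h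
    exact h
  have h1 := hrel _ (Subgroup.mem_comap.mp hmem)
  have heq : ∏ i, (Multiplicative.ofAdd (t i - t 0),
      Multiplicative.ofAdd (t' (σ i) - t' (σ 0))) ^ c i =
      (Multiplicative.ofAdd (∑ i, c i • t i), Multiplicative.ofAdd (∑ i, c i • t' (σ i))) := by
    ext
    · simp [Prod.fst_prod, smul_sub, ← Finset.sum_smul, hc0]
    · simp [Prod.snd_prod, smul_sub, ← Finset.sum_smul, hc0]
  rw [heq] at h1
  have h2 := h1 (by simp [φ, hc])
  exact Multiplicative.ofAdd.injective (SemidirectProduct.inl_injective h2)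

/-! ### The three connection sets -/

/-- The partial geometric sums `1 + x + ⋯ + x ^ (j - 1)` for `j = 0, …, 4`. They are the exponents of
`a` (with `x = r`) and of `b` (with `x = l`) in each of the three connection sets. -/
def partialSums {R : Type*} [CommRing R] (x : R) : Fin 5 → R :=
  ![0, 1, x + 1, x ^ 2 + x + 1, x ^ 3 + x ^ 2 + x + 1]

theorem sub_one_mul_partialSums {R : Type*} [CommRing R] (x : R) (j : Fin 5) :
    (x - 1) * partialSums x j = x ^ (j : ℕ) - 1 := by
  fin_cases j <;> simp [partialSums] <;> ring

/-- The complete homogeneous symmetric polynomials of degree `j - 2` in `1`, `x`, `κ`, for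
`j = 0, …, 4`; that is, the divided differences of `z ^ j` at these three points. They are the
exponents of `c`, with `κ = x ^ 4`, `x ^ 3`, `x ^ 2` for the three connection sets. -/
def completeSums {R : Type*} [CommRing R] (x κ : R) : Fin 5 → R :=
  ![0, 0, 1, κ + x + 1, κ ^ 2 + κ * x + x ^ 2 + κ + x + 1]

/-- The divided difference at `1`, `x`, `κ` measures the distance at `κ` between `z ^ j` and its
linear interpolation at `1` and `x`. -/
theorem mul_completeSums {R : Type*} [CommRing R] (x κ : R) (j : Fin 5) :
    (κ - 1) * (κ - x) * completeSums x κ j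
      = κ ^ (j : ℕ) - 1 - (κ - 1) * partialSums x j := by
  fin_cases j <;> simp [completeSums, partialSums] <;> ring

theorem map_partialSums {R S : Type*} [CommRing R] [CommRing S] (q : R →+* S) (x : R) (j : Fin 5) :
    q (partialSums x j) = partialSums (q x) j := by
  fin_cases j <;> simp [partialSums]

/-- The exponent vectors `(i, j, k)` of the elements `h a^i b^j c^k` of the connection set with
parameter `κ`. Up to an affine map they are the vectors `(r ^ j, l ^ j, κ ^ j)`. -/
def connectionPoints {m p e : ℕ} (r : ZMod m) (l : ZMod (p ^ e)) (κ : ZMod p) :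
    Fin 5 → ZMod m × ZMod (p ^ e) × ZMod p :=
  fun j => (partialSums r j, partialSums l j, completeSums l.cast κ j)

/-- The common form of the three connection sets, depending on the parameter `κ`. -/
def connectionSet {m p e : ℕ} (r : ZMod m) (l : ZMod (p ^ e)) (κ : ZMod p) :
    Set (CGDGroup m p e) :=
  Set.range fun j => Dih.reflection (Multiplicative.ofAdd (connectionPoints r l κ j))

theorem connectionSet_eq {m p e : ℕ} (r : ZMod m) (l : ZMod (p ^ e)) (κ : ZMod p) :
    connectionSet r l κ = {CGDGroup.h m p e,
      CGDGroup.h m p e * CGDGroup.abc 1 1 0,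
      CGDGroup.h m p e * CGDGroup.abc (r + 1) (l + 1) 1,
      CGDGroup.h m p e * CGDGroup.abc (r ^ 2 + r + 1) (l ^ 2 + l + 1) (κ + l.cast + 1),
      CGDGroup.h m p e * CGDGroup.abc (r ^ 3 + r ^ 2 + r + 1) (l ^ 3 + l ^ 2 + l + 1)
        (κ ^ 2 + κ * l.cast + l.cast ^ 2 + κ + l.cast + 1)} := by
  have h0 : CGDGroup.h m p e = CGDGroup.h m p e * CGDGroup.abc 0 0 0 := by
    conv_lhs => rw [← mul_one (CGDGroup.h m p e), ← map_one SemidirectProduct.inl]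
    rfl
  have hrange : ∀ f : Fin 5 → CGDGroup m p e, Set.range f = {f 0, f 1, f 2, f 3, f 4} := fun f => by
    ext g
    simp [Fin.exists_fin_succ, eq_comm]
  rw [connectionSet, hrange]
  have h1 : Dih.reflection (Multiplicative.ofAdd (connectionPoints r l κ 0)) =
      CGDGroup.h m p e := h0.symm
  rw [h1]
  rfl

theorem connectionPoints_sum_three {m p e : ℕ} (hp : p.Prime) (h11 : 11 ≤ p) (he : 2 ≤ e)
    {l : ZMod (p ^ e)} (hl : l ^ 4 + l ^ 3 + l ^ 2 + l + 1 = 0) (r : ZMod m) (κ : ZMod p)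
    (a b c d k i : Fin 5)
    (h : connectionPoints r l κ a + connectionPoints r l κ b + connectionPoints r l κ c =
      connectionPoints r l κ d + connectionPoints r l κ k + connectionPoints r l κ i) :
    a = d ∨ a = k ∨ a = i := by
  refine powers_sum_three (b := b) (c := c) hp h11 he hl ?_
  have h1 := congrArg (fun t => t.2.1) h
  simp only [connectionPoints, Prod.snd_add, Prod.fst_add] at h1
  linear_combination (l - 1) * h1 - sub_one_mul_partialSums l a - sub_one_mul_partialSums l b
    - sub_one_mul_partialSums l c + sub_one_mul_partialSums l d + sub_one_mul_partialSums l k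
    + sub_one_mul_partialSums l i

/-- The graph determines the exponent `i` in the parameter `κ = l ^ i` of its connection set. -/
theorem exponents_eq_of_iso {m p e : ℕ} (hp : p.Prime) (h11 : 11 ≤ p) (he : 2 ≤ e)
    (hmp : Nat.Coprime m p) (r : ZMod m) {l : ZMod (p ^ e)} (h5 : l ^ 5 = 1) (hl1 : l ≠ 1)
    {i i' : ℕ} (hi : i ∈ Set.Icc 2 4) (hi' : i' ∈ Set.Icc 2 4)
    (f : cayleyGraph (connectionSet r l (l.cast ^ i)) ≃g
      cayleyGraph (connectionSet r l (l.cast ^ i'))) : i = i' := by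
  have : Fact p.Prime := ⟨hp⟩
  have h : p ∣ p ^ e := dvd_pow_self p (by omega)
  have hl := cyclotomic_five_eq_zero hp h11 h h5 hl1
  obtain ⟨x, hx⟩ : ∃ x : ZMod p, x = l.cast := ⟨_, rfl⟩
  have hlx : ZMod.castHom h (ZMod p) l = x := by rw [ZMod.castHom_apply, hx]
  have hx1 : x ≠ 1 := hlx ▸ castHom_ne_one_of_pow_five_eq_one hp h11 h h5 hl1
  have hx5 : x ^ 5 = 1 := by rw [← hlx, ← map_pow, h5, map_one]
  have hord : orderOf x = 5 :=
    have : Fact (Nat.Prime 5) := ⟨by norm_num⟩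
    orderOf_eq_prime hx5 hx1
  have hinj : ∀ {a b : ℕ}, a < 5 → b < 5 → x ^ a = x ^ b → a = b := fun ha hb hab =>
    pow_injOn_Iio_orderOf (hord.symm ▸ ha) (hord.symm ▸ hb) hab
  have hne1 : ∀ {a : ℕ}, a ∈ Set.Icc 2 4 → x ^ a ≠ 1 := fun {a} ha h => by
    have := hinj (a := a) (b := 0) (by have := ha.2; omega) (by norm_num) (by rw [h, pow_zero])
    have := ha.1
    omega
  have hnex : ∀ {a : ℕ}, a ∈ Set.Icc 2 4 → x ^ a ≠ x := fun {a} ha h => by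
    have := hinj (a := a) (b := 1) (by have := ha.2; omega) (by norm_num) (by rw [h, pow_one])
    have := ha.1
    omega
  rw [← hx] at f
  have hsum := fun κ => connectionPoints_sum_three (m := m) hp h11 he hl r κ
  have htinj : Function.Injective (connectionPoints r l (x ^ i)) := fun a b hab => by
    rcases hsum (x ^ i) a a a b b b (by rw [hab]) with h | h | h <;> exact h
  obtain ⟨σ, hσ, hrel⟩ := exists_bijective_relations_preserved_of_sum_three htinj
    (hsum (x ^ i')) f
  have hum : (m : ZMod p) ≠ 0 := fun h0 => by
    rw [ZMod.natCast_eq_zero_iff] at h0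
    exact hp.one_lt.ne' (Nat.dvd_one.mp (hmp ▸ Nat.dvd_gcd h0 dvd_rfl))
  have hum' : IsUnit (m : ZMod (p ^ e)) := by
    apply isUnit_of_castHom_ne_zero hp h
    rwa [map_natCast]
  have hpow : x ^ i = x ^ i' := by
    refine exponents_eq_of_relations_preserved h11 he h hl hlx hx1 rfl (hne1 hi) (hnex hi)
      (hne1 hi') (hnex hi') (sub_one_mul_partialSums l) (C := completeSums x (x ^ i))
      (C' := completeSums x (x ^ i')) (fun j => ?_) (fun j => ?_) hσ fun n hn hnB hnC => ?_
    · rw [map_partialSums, hlx, mul_completeSums]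
    · rw [map_partialSums, hlx, mul_completeSums]
    · -- multiplying a relation by `m` makes it hold in the factor `ZMod m` as well, and loses
      -- nothing in the other two factors
      have hm := hrel (fun j => m * n j) (by rw [← Finset.mul_sum, hn, mul_zero]) (by
        ext
        · simp [connectionPoints, Prod.fst_sum]
        · simp [connectionPoints, Prod.fst_sum, Prod.snd_sum, mul_assoc, ← Finset.mul_sum, hnB]
        · simp [connectionPoints, Prod.snd_sum, mul_assoc, ← Finset.mul_sum, ← hx, hnC])
      have h1 := congrArg (fun t => t.2.1) hm
      have h2 := congrArg (fun t => t.2.2) hm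
      simp [connectionPoints, Prod.fst_sum, Prod.snd_sum, mul_assoc, ← Finset.mul_sum] at h1
      simp [connectionPoints, Prod.snd_sum, mul_assoc, ← Finset.mul_sum, ← hx] at h2
      exact ⟨(hum'.mul_right_eq_zero).mp h1, h2.resolve_left hum⟩
  have h2 := hi.2
  have h2' := hi'.2
  exact hinj (by omega) (by omega) hpow

theorem mainTheorem7 (m p e : ℕ) (hm : 0 < m) (hp : p.Prime) (he : 2 ≤ e)
    (hmp : Nat.Coprime m p) (hp5 : 5 ∣ p - 1)
    (r : ZMod m) (hr : r ^ 4 + r ^ 3 + r ^ 2 + r + 1 = 0)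
    (l : (ZMod (p ^ e))ˣ) (hl : orderOf l = 5) :
    IsEmpty (CGD₁ (p := p) (e := e) r l ≃g CGD₂ (p := p) (e := e) r l) ∧
    IsEmpty (CGD₁ (p := p) (e := e) r l ≃g CGD₃ (p := p) (e := e) r l) ∧
    IsEmpty (CGD₂ (p := p) (e := e) r l ≃g CGD₃ (p := p) (e := e) r l) := by
  have h11 := eleven_le_of_five_dvd_sub_one hp hp5
  have h : p ∣ p ^ e := dvd_pow_self p (by omega)
  have h5 : (l : ZMod (p ^ e)) ^ 5 = 1 := by
    rw [← Units.val_pow_eq_pow_val, ← hl, pow_orderOf_eq_one, Units.val_one]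
  have hl1 : (l : ZMod (p ^ e)) ≠ 1 := fun h1 => by
    rw [Units.ext (h1.trans Units.val_one.symm), orderOf_one] at hl
    exact absurd hl (by norm_num)
  have key := fun {i i' : ℕ} => exponents_eq_of_iso (i := i) (i' := i') hp h11 he hmp r h5 hl1
  have hΦ := cyclotomic_five_eq_zero hp h11 h h5 hl1
  generalize (l : ZMod (p ^ e)) = l at h5 hl1 key hΦ ⊢
  have hx : (l.cast : ZMod p) ^ 4 + (l.cast : ZMod p) ^ 3 + (l.cast : ZMod p) ^ 2 + l.cast + 1
      = 0 := by
    simpa only [map_add, map_pow, map_one, map_zero, ZMod.castHom_apply] using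
      congrArg (ZMod.castHom h (ZMod p)) hΦ
  have hx5 : (l.cast : ZMod p) ^ 5 = 1 := by
    linear_combination ((l.cast : ZMod p) - 1) * hx
  have hT₁ : T₁ r l = connectionSet r l (l.cast ^ 4) := by
    rw [connectionSet_eq, show ((l.cast : ZMod p) ^ 4) ^ 2 + l.cast ^ 4 * l.cast + l.cast ^ 2
      + l.cast ^ 4 + l.cast + 1 = 1 by linear_combination ((l.cast : ZMod p) ^ 3 + 1) * hx5 + hx]
    rfl
  have hT₂ : T₂ r l = connectionSet r l (l.cast ^ 3) := by
    rw [connectionSet_eq, show ((l.cast : ZMod p) ^ 3) ^ 2 + l.cast ^ 3 * l.cast + l.cast ^ 2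
      + l.cast ^ 3 + l.cast + 1 = l.cast by linear_combination (l.cast : ZMod p) * hx5 + hx]
    rfl
  have hT₃ : T₃ r l = connectionSet r l (l.cast ^ 2) := by
    rw [connectionSet_eq, show ((l.cast : ZMod p) ^ 2) ^ 2 + l.cast ^ 2 * l.cast + l.cast ^ 2
      + l.cast ^ 2 + l.cast + 1 = l.cast ^ 2 by linear_combination hx]
    rfl
  rw [CGD₁, CGD₂, CGD₃, hT₁, hT₂, hT₃]
  refine ⟨⟨fun f => ?_⟩, ⟨fun f => ?_⟩, ⟨fun f => ?_⟩⟩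
  · exact absurd (key (by norm_num) (by norm_num) f) (by norm_num)
  · exact absurd (key (by norm_num) (by norm_num) f) (by norm_num)
  · exact absurd (key (by norm_num) (by norm_num) f) (by norm_num)
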